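/- A $(k,g)$-graph is a finite simple $k$-regular graph of girth $g$. For even $g=2d$ the Moore bound is $M(k,g)=2\left(1+(k-1)+\dots+(k-1)^{d-1}\right)$, and the excess of a $(k,g)$-graph with $n$ vertices is $n-M(k,g)$. The excess graph $G(E)$ of a $(k,2d)$-graph $G$ of excess $4$ is the graph on the vertex set of $G$ in which two vertices are adjacent if and only if their distance in $G$ is $d+1$. Theorem. Let $k\ge 7$ be odd, let $g=2d\ge 8$, and let $G$ be a $(k,g)$-graph of excess $4$. Then $G(E)$ is a disjoint union of cycles. Moreover, let $c$ be the number of cycles of $G(E)$ and let $c_2$ be the number of those of even length. 1) If $d$ is odd, then $d-1$ divides both $c-2$ and $c_2$. 2) If $d$ is even, then $d-1$ divides both $c-1$ and $c_2-1$. -/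

import Mathlib

namespace CageExcess

/-- A `(k, g)`-graph: a finite simple graph that is `k`-regular and has girth `g`. -/
structure IsKGGraph {V : Type*} [Fintype V] (G : SimpleGraph V) [DecidableRel G.Adj]
    (k g : ℕ) : Prop where
  regular : G.IsRegularOfDegree k
  girth_eq : G.girth = g

/-- The Moore bound `M(k, g)`:
`1 + k + k(k-1) + ... + k(k-1)^((g-3)/2)` for odd `g`, and
`2 (1 + (k-1) + ... + (k-1)^((g-2)/2))` for even `g`. -/
def mooreBound (k g : ℕ) : ℤ :=
  if Odd g then 1 + ∑ i ∈ Finset.range ((g - 1) / 2), (k : ℤ) * ((k : ℤ) - 1) ^ i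
  else 2 * ∑ i ∈ Finset.range (g / 2), ((k : ℤ) - 1) ^ i

/-- The excess of a `(k, g)`-graph on the vertex set `V`: its order minus the Moore bound. -/
def excess (V : Type*) [Fintype V] (k g : ℕ) : ℤ :=
  (Fintype.card V : ℤ) - mooreBound k g

/-- The excess graph `G(E)` of a graph `G` of girth `2d`: it has the same vertices as `G`, and
two vertices are adjacent exactly when they are at distance `d + 1` in `G`. (`SimpleGraph.dist`
is `0` on pairs of vertices that are not connected, so such pairs are never adjacent here.) -/
def excessGraph {V : Type*} (G : SimpleGraph V) (d : ℕ) : SimpleGraph V where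
  Adj u v := G.dist u v = d + 1
  symm := ⟨fun u v h => by rw [SimpleGraph.dist_comm]; exact h⟩
  loopless := ⟨fun u h => by simp at h⟩

/-- The connected component `C` of `H` is a cycle of length `l` (with `l ≥ 3`). -/
def IsCycleOfLength {V : Type*} {H : SimpleGraph V} (C : H.ConnectedComponent) (l : ℕ) : Prop :=
  3 ≤ l ∧ Nonempty (C.toSimpleGraph ≃g SimpleGraph.cycleGraph l)

/-- `H` is a disjoint union of cycles: every connected component of `H` is a cycle. -/
def IsDisjointUnionOfCycles {V : Type*} (H : SimpleGraph V) : Prop :=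
  ∀ C : H.ConnectedComponent, ∃ l : ℕ, IsCycleOfLength C l

/-- The number of components of `H` that are cycles; for a disjoint union of cycles this is the
number `c` of its cycles. -/
noncomputable def numCycles {V : Type*} (H : SimpleGraph V) : ℕ :=
  {C : H.ConnectedComponent | ∃ l : ℕ, IsCycleOfLength C l}.ncard

/-- The number of components of `H` that are cycles of even length; for a disjoint union of
cycles this is the number `c₂` of its even cycles. -/
noncomputable def numEvenCycles {V : Type*} (H : SimpleGraph V) : ℕ :=
  {C : H.ConnectedComponent | ∃ l : ℕ, Even l ∧ IsCycleOfLength C l}.ncard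

end CageExcess

/-! The proof is spectral. Growing trees from both ends of an edge uses up the Moore bound, so at
most 4 vertices lie at distance at least d from both ends (`card_farSet_le`). As 4 is small compared
with k ≥ 7, G is connected, has diameter at most d + 1, and no vertex is equidistant from the ends
of an edge (`dist_ne_of_adj`). So G is bipartite, with sign vector s(y) = (-1)^dist(o, y).

Let A be the adjacency operator, q = k - 1 and P_n the polynomials `distPoly q n`. For n < d, P_n(A)
sums over the vertices at distance at most n with the parity of n. Vertices at distance d + 1 are
those of the parity of d + 1 not at distance at most d - 1, so the adjacency operator of G(E) is E =
(J + (-1)^(d+1) s sᵀ)/2 - P_{d-1}(A), where J is the all-ones matrix (`adjEnd_excessGraph`). Applied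
to constants this shows that G(E) is 2-regular, hence a union of cycles.

For t = ±1, the eigenspace of E for 2t consists of the functions multiplied by t along every edge of
G(E); its dimension is c for t = 1 and c₂ for t = -1. On functions orthogonal to 1 and s, E is
-P_{d-1}(A), so there this eigenspace is the kernel of P_{d-1}(A) + 2t. For k odd and d ≥ 4, P_{d-1}
+ 2t is Eisenstein at 2, so the kernel is a vector space over a field of degree d - 1 over ℚ, and d
- 1 divides its dimension. The vector 1 belongs to t = 1 and s to t = (-1)^(d+1), which gives the
corrections to c and c₂. -/

namespace CageExcess

/-! ### Distances below half the girth. -/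

section Girth

variable {V : Type*} {G : SimpleGraph V} {d : ℕ}

/-- Paths between the same two vertices whose total length is below the girth coincide. -/
lemma isPath_unique_of_length_lt_girth {x y : V} {p q : G.Walk x y} (hp : p.IsPath)
    (hq : q.IsPath) (h : p.length + q.length < G.girth) : p = q := by
  by_contra hne
  obtain ⟨w, -, -, c, hc, hl⟩ := hp.exists_isCycle_length_le_add_of_ne hq hne
  have := SimpleGraph.girth_le_length hc
  omega

/-- Within distance less than half the girth, the predecessor on a geodesic is unique. -/
lemma eq_of_adj_of_dist_eq (hg : 2 * d ≤ G.girth) {x y a b : V} {j : ℕ} (hj : j + 1 < d)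
    (hy : G.dist x y = j + 1) (ha : G.Adj y a) (hb : G.Adj y b)
    (hxa : G.dist x a = j) (hxb : G.dist x b = j) : a = b := by
  have hr : G.Reachable x y := SimpleGraph.Reachable.of_dist_ne_zero (by omega)
  obtain ⟨p, hp⟩ := (hr.trans ha.reachable).symm.exists_walk_length_eq_dist
  obtain ⟨q, hq⟩ := (hr.trans hb.reachable).symm.exists_walk_length_eq_dist
  rw [SimpleGraph.dist_comm] at hp hq
  have hpp : (SimpleGraph.Walk.cons ha p).IsPath :=
    SimpleGraph.Walk.isPath_of_length_eq_dist _ (by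
      rw [SimpleGraph.dist_comm (u := y), SimpleGraph.Walk.length_cons]; omega)
  have hqp : (SimpleGraph.Walk.cons hb q).IsPath :=
    SimpleGraph.Walk.isPath_of_length_eq_dist _ (by
      rw [SimpleGraph.dist_comm (u := y), SimpleGraph.Walk.length_cons]; omega)
  have h := isPath_unique_of_length_lt_girth hpp hqp (by
    simp only [SimpleGraph.Walk.length_cons]; omega)
  have := congrArg SimpleGraph.Walk.snd h
  simpa using this

/-- Adjacent vertices are not at the same distance, if it is less than half the girth, from a
third vertex. -/
lemma dist_ne_of_adj_of_lt (hg : 2 * d ≤ G.girth) {x a b : V} (hab : G.Adj a b)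
    (hr : G.Reachable x a) (h : G.dist x a < d) : G.dist x a ≠ G.dist x b := by
  classical
  intro he
  obtain ⟨p, hp⟩ := hr.symm.exists_walk_length_eq_dist
  obtain ⟨q, hq⟩ := (hr.trans hab.reachable).symm.exists_walk_length_eq_dist
  have hpp := p.isPath_of_length_eq_dist hp
  have hqp := q.isPath_of_length_eq_dist hq
  rw [SimpleGraph.dist_comm] at hp hq
  have hcp : (SimpleGraph.Walk.cons hab q).IsPath := by
    refine hqp.cons fun ha => ?_
    have h1 := congrArg SimpleGraph.Walk.length (q.take_spec ha)
    rw [SimpleGraph.Walk.length_append] at h1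
    have h2 := SimpleGraph.dist_le (q.dropUntil a ha)
    rw [SimpleGraph.dist_comm] at h2
    have h3 : (q.takeUntil a ha).length = 0 := by omega
    exact hab.ne (SimpleGraph.Walk.eq_of_length_eq_zero h3).symm
  have h := isPath_unique_of_length_lt_girth hpp hcp (by
    simp only [SimpleGraph.Walk.length_cons]; omega)
  have := congrArg SimpleGraph.Walk.length h
  simp only [SimpleGraph.Walk.length_cons] at this
  omega

lemma dist_le_succ_of_adj {x a b : V} (h : G.Adj a b) : G.dist x b ≤ G.dist x a + 1 := by
  rcases h.diff_dist_adj (u := x) with h | h | h <;> omega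

/-- A vertex at positive distance has a neighbour one step closer. -/
lemma exists_adj_dist_eq {x y : V} {j : ℕ} (h : G.dist x y = j + 1) :
    ∃ w, G.Adj y w ∧ G.dist x w = j := by
  obtain ⟨p, hp⟩ := SimpleGraph.exists_walk_of_dist_ne_zero
    (show G.dist y x ≠ 0 by rw [SimpleGraph.dist_comm]; omega)
  rw [SimpleGraph.dist_comm, h] at hp
  cases p with
  | nil => simp at hp
  | cons hw q =>
    refine ⟨_, hw, ?_⟩
    rw [SimpleGraph.Walk.length_cons] at hp
    have h1 := SimpleGraph.dist_le q
    rw [SimpleGraph.dist_comm] at h1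
    have h2 := dist_le_succ_of_adj (x := x) hw.symm
    omega

end Girth

/-! ### The Moore tree of an edge, and connectedness. -/

section Counting

open Finset

variable {V : Type*} [Fintype V] {G : SimpleGraph V} [DecidableRel G.Adj] {k d : ℕ}

/-- The vertices at distance `i` from `u` and `i + 1` from `v`. -/
noncomputable def edgeSphere (G : SimpleGraph V) (u v : V) (i : ℕ) : Finset V :=
  {x | G.dist u x = i ∧ G.dist v x = i + 1}

/-- The vertices at distance at least `d` from both `u` and `v`. -/
noncomputable def farSet (G : SimpleGraph V) (d : ℕ) (u v : V) : Finset V :=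
  {x | d ≤ G.dist u x ∧ d ≤ G.dist v x}

/-- Double counting of the edges between consecutive layers: a vertex of layer i has at most one
neighbour closer to v and none at its own level, so at least k - 1 in layer i + 1, while each vertex
of layer i + 1 has at most one predecessor. -/
lemma pow_le_card_edgeSphere (hr : G.IsRegularOfDegree k) (hg : 2 * d ≤ G.girth) {u v : V}
    (huv : G.Adj u v) {i : ℕ} (hi : i < d) : (k - 1) ^ i ≤ #(edgeSphere G u v i) := by
  classical
  induction i with
  | zero =>
    rw [pow_zero]
    refine card_pos.2 ⟨u, ?_⟩
    simp [edgeSphere, huv.symm]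
  | succ i ih =>
    have ih := ih (by omega)
    have key : #(edgeSphere G u v i) * (k - 1) ≤ #(edgeSphere G u v (i + 1)) * 1 := by
      refine card_mul_le_card_mul G.Adj (fun a ha => ?_) (fun b hb => ?_)
      · simp only [edgeSphere, mem_filter, mem_univ, true_and] at ha
        have hra : G.Reachable v a := SimpleGraph.Reachable.of_dist_ne_zero (by omega)
        have h1 : #{y ∈ G.neighborFinset a | G.dist v y = i} ≤ 1 := by
          refine card_le_one.2 fun y hy z hz => ?_
          simp only [mem_filter, SimpleGraph.mem_neighborFinset] at hy hz
          exact eq_of_adj_of_dist_eq hg hi ha.2 hy.1 hz.1 hy.2 hz.2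
        have h2 : G.neighborFinset a ⊆ {y ∈ G.neighborFinset a | G.dist v y = i} ∪
            (edgeSphere G u v (i + 1)).bipartiteAbove G.Adj a := by
          intro y hy
          rw [SimpleGraph.mem_neighborFinset] at hy
          simp only [mem_union, mem_filter, SimpleGraph.mem_neighborFinset, mem_bipartiteAbove,
            edgeSphere, mem_univ, true_and]
          have e1 := dist_ne_of_adj_of_lt hg hy hra (by omega)
          have e2 := hy.diff_dist_adj (u := v)
          by_cases e3 : G.dist v y = i
          · exact Or.inl ⟨hy, e3⟩
          · have e4 : G.dist v y = i + 1 + 1 := by omega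
            have e5 := dist_le_succ_of_adj (x := u) hy
            have hry : G.Reachable u y :=
              huv.reachable.trans (SimpleGraph.Reachable.of_dist_ne_zero (by omega))
            have e6 := huv.symm.reachable.dist_triangle_left y
            rw [SimpleGraph.dist_eq_one_iff_adj.2 huv.symm] at e6
            exact Or.inr ⟨⟨by omega, e4⟩, hy⟩
        have h3 := (card_le_card h2).trans (card_union_le _ _)
        rw [SimpleGraph.card_neighborFinset_eq_degree, hr a] at h3
        omega
      · simp only [edgeSphere, mem_filter, mem_univ, true_and] at hb
        refine card_le_one.2 fun y hy z hz => ?_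
        simp only [mem_bipartiteBelow, edgeSphere, mem_filter, mem_univ, true_and] at hy hz
        exact eq_of_adj_of_dist_eq hg hi hb.1 hy.2.symm hz.2.symm hy.1.1 hz.1.1
    calc (k - 1) ^ (i + 1) = (k - 1) ^ i * (k - 1) := pow_succ _ _
      _ ≤ #(edgeSphere G u v i) * (k - 1) := Nat.mul_le_mul_right _ ih
      _ ≤ _ := by simpa using key

/-- The geometric sum `∑ i < d, (k - 1) ^ i`, half the Moore bound for girth `2 d`. -/
def halfMoore (k d : ℕ) : ℕ := ∑ i ∈ range d, (k - 1) ^ i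

/-- The layers on the two sides of the edge are pairwise disjoint, so whatever avoids them is
bounded by the excess. It is applied to the neighbourhood of a vertex in another component and to
`farSet`. -/
lemma two_mul_halfMoore_add_card_le (hr : G.IsRegularOfDegree k) (hg : 2 * d ≤ G.girth) {u v : V}
    (huv : G.Adj u v) {D : Finset V}
    (hD : ∀ x ∈ D, ∀ i < d, x ∉ edgeSphere G u v i ∧ x ∉ edgeSphere G v u i) :
    2 * halfMoore k d + #D ≤ Fintype.card V := by
  classical
  have hc : ∀ a b : V, G.Adj a b →
      halfMoore k d ≤ #((range d).biUnion (edgeSphere G a b)) := by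
    intro a b hab
    rw [card_biUnion]
    · exact sum_le_sum fun i hi => pow_le_card_edgeSphere hr hg hab (mem_range.1 hi)
    · intro i _ j _ hij
      refine disjoint_left.2 fun x hx hy => hij ?_
      simp only [edgeSphere, mem_filter, mem_univ, true_and] at hx hy
      omega
  have h1 : Disjoint ((range d).biUnion (edgeSphere G u v))
      ((range d).biUnion (edgeSphere G v u)) := by
    refine disjoint_left.2 fun x hx hy => ?_
    simp only [mem_biUnion, edgeSphere, mem_filter, mem_univ, true_and] at hx hy
    obtain ⟨i, -, hi⟩ := hx
    obtain ⟨j, -, hj⟩ := hy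
    omega
  have h2 : Disjoint (((range d).biUnion (edgeSphere G u v)) ∪
      ((range d).biUnion (edgeSphere G v u))) D := by
    refine disjoint_left.2 fun x hx hy => ?_
    simp only [mem_union, mem_biUnion, mem_range] at hx
    rcases hx with ⟨i, hi, hx⟩ | ⟨i, hi, hx⟩
    · exact (hD x hy i hi).1 hx
    · exact (hD x hy i hi).2 hx
  have h3 := card_le_univ ((((range d).biUnion (edgeSphere G u v)) ∪
      ((range d).biUnion (edgeSphere G v u))) ∪ D)
  rw [card_union_of_disjoint h2, card_union_of_disjoint h1] at h3
  have h4 := hc u v huv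
  have h5 := hc v u huv.symm
  omega

/-- A regular graph whose order exceeds the Moore bound by less than its degree is connected. -/
lemma connected_of_card (hr : G.IsRegularOfDegree k) (hg : 2 * d ≤ G.girth) {e : ℕ}
    (hek : e < k) (hn : Fintype.card V = 2 * halfMoore k d + e) [Nonempty V] : G.Connected := by
  classical
  refine SimpleGraph.connected_iff _ |>.2 ⟨fun u x => ?_, inferInstance⟩
  by_contra hux
  obtain ⟨v, huv⟩ : ∃ v, G.Adj u v := by
    rw [← SimpleGraph.degree_pos_iff_exists_adj, hr u]; omega
  have h := two_mul_halfMoore_add_card_le hr hg huv (D := G.neighborFinset x) (by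
    intro y hy i _
    rw [SimpleGraph.mem_neighborFinset] at hy
    have huy : ¬ G.Reachable u y := fun h => hux (h.trans hy.symm.reachable)
    have hvy : ¬ G.Reachable v y := fun h => huy (huv.reachable.trans h)
    -- Unreachable vertices have `dist` equal to 0 from both ends, which cannot satisfy 0 = i + 1,
    -- so they lie in no layer.
    simp [edgeSphere, SimpleGraph.dist_eq_zero_of_not_reachable huy,
      SimpleGraph.dist_eq_zero_of_not_reachable hvy])
  rw [SimpleGraph.card_neighborFinset_eq_degree, hr x] at h
  omega

lemma card_farSet_le (hr : G.IsRegularOfDegree k) (hg : 2 * d ≤ G.girth) {e : ℕ}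
    (hn : Fintype.card V = 2 * halfMoore k d + e) {u v : V} (huv : G.Adj u v) :
    #(farSet G d u v) ≤ e := by
  have h := two_mul_halfMoore_add_card_le hr hg huv (D := farSet G d u v) (by
    intro x hx i hi
    simp only [farSet, mem_filter, mem_univ, true_and] at hx
    simp only [edgeSphere, mem_filter, mem_univ, true_and]
    omega)
  omega

end Counting

/-! ### Small excess forces a bipartite graph of diameter at most d + 1. -/

section Bipartite

open Finset

variable {V : Type*} [Fintype V] {G : SimpleGraph V} [DecidableRel G.Adj] {k d e : ℕ}

/-- The neighbours of `y` at distance `d - 1` from `x`. -/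
noncomputable def nearNbrs (G : SimpleGraph V) [DecidableRel G.Adj] (d : ℕ) (x y : V) : Finset V :=
  {w ∈ G.neighborFinset y | G.dist x w + 1 = d}

/-- A geodesic from y to x that leaves through w enters x through some z with dist(w, z) = d - 2.
Since dist(z, y) = d - 1 < d, uniqueness of predecessors shows that z determines w. -/
lemma card_nearNbrs_le_comm (hg : 2 * d ≤ G.girth) (hc : G.Connected) (hd : 2 ≤ d) {x y : V}
    (hxy : G.dist x y = d) : #(nearNbrs G d x y) ≤ #(nearNbrs G d y x) := by
  refine card_le_card_of_forall_subsingleton (fun w z => G.dist w z + 2 = d) (fun w hw => ?_)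
    (fun z hz => ?_)
  · simp only [nearNbrs, mem_filter, SimpleGraph.mem_neighborFinset] at hw
    obtain ⟨z, hz, hwz⟩ := exists_adj_dist_eq (G := G) (x := w) (y := x) (j := d - 2)
      (by rw [SimpleGraph.dist_comm]; omega)
    refine ⟨z, ?_, by omega⟩
    simp only [nearNbrs, mem_filter, SimpleGraph.mem_neighborFinset]
    refine ⟨hz, ?_⟩
    have h1 := hc.dist_triangle (u := x) (v := z) (w := y)
    have h2 := hc.dist_triangle (u := y) (v := w) (w := z)
    rw [SimpleGraph.dist_eq_one_iff_adj.2 hz] at h1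
    rw [SimpleGraph.dist_eq_one_iff_adj.2 hw.1] at h2
    rw [SimpleGraph.dist_comm (u := z)] at h1
    omega
  · simp only [nearNbrs, mem_filter, SimpleGraph.mem_neighborFinset] at hz
    intro a ha b hb
    simp only [nearNbrs, mem_filter, SimpleGraph.mem_neighborFinset, Set.mem_ofPred_eq] at ha hb
    refine eq_of_adj_of_dist_eq (j := d - 2) hg (by omega) (x := z) (y := y) ?_ ha.1.1 hb.1.1 ?_ ?_
    · rw [SimpleGraph.dist_comm]; omega
    · rw [SimpleGraph.dist_comm]; omega
    · rw [SimpleGraph.dist_comm]; omega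

lemma card_nearNbrs_comm (hg : 2 * d ≤ G.girth) (hc : G.Connected) (hd : 2 ≤ d) {x y : V}
    (hxy : G.dist x y = d) : #(nearNbrs G d x y) = #(nearNbrs G d y x) :=
  (card_nearNbrs_le_comm hg hc hd hxy).antisymm
    (card_nearNbrs_le_comm hg hc hd (by rwa [SimpleGraph.dist_comm]))

/-- Take a neighbour p of y at distance d - 1 from x. A neighbour of x not at distance d - 1 from y
is at distance at least d from both y and p, so at most e of them exist. This counts around x;
symmetry transfers the bound to y. -/
lemma le_card_nearNbrs (hr : G.IsRegularOfDegree k) (hg : 2 * d ≤ G.girth) (hd : 2 ≤ d)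
    (hc : G.Connected) (hD : ∀ u v, G.Adj u v → #(farSet G d u v) ≤ e) {x y : V}
    (hxy : G.dist x y = d) : k ≤ #(nearNbrs G d x y) + e := by
  classical
  obtain ⟨p, hp, hxp⟩ := exists_adj_dist_eq (G := G) (x := x) (y := y) (j := d - 1) (by omega)
  rw [card_nearNbrs_comm hg hc hd hxy]
  have h2 : G.neighborFinset x ⊆ nearNbrs G d y x ∪ farSet G d p y := by
    intro z hz
    rw [SimpleGraph.mem_neighborFinset] at hz
    simp only [mem_union, nearNbrs, farSet, mem_filter, SimpleGraph.mem_neighborFinset, mem_univ,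
      true_and]
    have e1 := dist_le_succ_of_adj (x := y) hz.symm
    rw [SimpleGraph.dist_comm (v := x)] at e1
    have e2 := dist_ne_of_adj_of_lt hg hz (hc p x)
      (by rw [SimpleGraph.dist_comm]; omega)
    have e3 := dist_le_succ_of_adj (x := p) hz.symm
    have e4 := hc.dist_triangle (u := y) (v := p) (w := z)
    rw [SimpleGraph.dist_eq_one_iff_adj.2 hp] at e4
    rw [SimpleGraph.dist_comm (v := x)] at e2 e3
    by_cases e5 : G.dist y z + 1 = d
    · exact Or.inl ⟨hz, e5⟩
    · right
      omega
  have h3 := (card_le_card h2).trans (card_union_le _ _)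
  rw [SimpleGraph.card_neighborFinset_eq_degree, hr x] at h3
  have := hD p y hp.symm
  omega

/-- A vertex at distance d - 1 from both ends of an edge would close an odd cycle shorter than the
girth, so the two sets of neighbours are disjoint. -/
lemma card_nearNbrs_add_le (hr : G.IsRegularOfDegree k) (hg : 2 * d ≤ G.girth)
    (hc : G.Connected) {u v y : V} (huv : G.Adj u v) :
    #(nearNbrs G d u y) + #(nearNbrs G d v y) ≤ k := by
  classical
  rw [← hr y, ← SimpleGraph.card_neighborFinset_eq_degree, ← card_union_of_disjoint]
  · exact card_le_card (union_subset (filter_subset _ _) (filter_subset _ _))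
  · refine disjoint_left.2 fun w hw hw' => ?_
    simp only [nearNbrs, mem_filter] at hw hw'
    have := dist_ne_of_adj_of_lt hg huv (hc w u) (by rw [SimpleGraph.dist_comm]; omega)
    rw [SimpleGraph.dist_comm, SimpleGraph.dist_comm (v := v)] at this
    omega

/-- In small excess, no vertex is at distance `d` from both ends of an edge. -/
lemma not_dist_eq_and_dist_eq (hr : G.IsRegularOfDegree k) (hg : 2 * d ≤ G.girth) (hd : 3 ≤ d)
    (hc : G.Connected) (hD : ∀ u v, G.Adj u v → #(farSet G d u v) ≤ e)
    (he : e + 2 ≤ k) (hek : 3 * e + 2 ≤ 2 * k) {u v y : V} (huv : G.Adj u v)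
    (hu : G.dist u y = d) (hv : G.dist v y = d) : False := by
  classical
  -- Such a p is at distance d from v. At least k - e near neighbours of v point towards y, which
  -- leaves at most e pointing towards p; by symmetry at least k - e neighbours of p are not near v,
  -- and these are far from both u and v.
  have key : ∀ p ∈ nearNbrs G d u y, y ∈ G.neighborFinset p ∩ farSet G d u v ∧
      k ≤ #(G.neighborFinset p ∩ farSet G d u v) + e := by
    intro p hp
    simp only [nearNbrs, mem_filter, SimpleGraph.mem_neighborFinset] at hp
    have hvp : G.dist v p = d := by
      have e1 := dist_ne_of_adj_of_lt hg huv (hc p u) (by rw [SimpleGraph.dist_comm]; omega)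
      rw [SimpleGraph.dist_comm, SimpleGraph.dist_comm (v := v)] at e1
      have e2 := dist_le_succ_of_adj (x := v) hp.1.symm
      have e3 := dist_le_succ_of_adj (x := p) huv
      rw [SimpleGraph.dist_comm, SimpleGraph.dist_comm (v := u)] at e3
      omega
    refine ⟨by simp [farSet, hp.1.symm, hu, hv], ?_⟩
    have h1 := card_nearNbrs_add_le (d := d) hr hg hc (y := v) hp.1
    have h2 := le_card_nearNbrs hr hg (by omega) hc hD hv
    have h3 := card_nearNbrs_comm hg hc (by omega) hvp
    have h4 := card_nearNbrs_comm hg hc (by omega) hv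
    have h5 : G.neighborFinset p ⊆ nearNbrs G d v p ∪ (G.neighborFinset p ∩ farSet G d u v) := by
      intro w hw
      rw [mem_union, mem_inter]
      refine or_iff_not_imp_left.2 fun hn => ⟨hw, ?_⟩
      rw [SimpleGraph.mem_neighborFinset] at hw
      simp only [nearNbrs, mem_filter, SimpleGraph.mem_neighborFinset, not_and] at hn
      have hn := hn hw
      have e1 := dist_le_succ_of_adj (x := v) hw.symm
      have e2 := dist_ne_of_adj_of_lt hg hw (hc u p) (by omega)
      have e3 := dist_le_succ_of_adj (x := u) hw.symm
      have e4 := dist_le_succ_of_adj (x := w) huv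
      rw [SimpleGraph.dist_comm, SimpleGraph.dist_comm (v := u)] at e4
      simp only [farSet, mem_filter, mem_univ, true_and]
      omega
    have h6 := (card_le_card h5).trans (card_union_le _ _)
    rw [SimpleGraph.card_neighborFinset_eq_degree, hr p] at h6
    omega
  have h1 := le_card_nearNbrs hr hg (by omega) hc hD hu
  obtain ⟨p, hp, q, hq, hpq⟩ := one_lt_card.1 (show 1 < #(nearNbrs G d u y) by omega)
  obtain ⟨hyp, hcp⟩ := key p hp
  obtain ⟨hyq, hcq⟩ := key q hq
  have h2 := card_union_add_card_inter (G.neighborFinset p ∩ farSet G d u v)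
    (G.neighborFinset q ∩ farSet G d u v)
  have h3 := card_le_card (union_subset
    (inter_subset_right (s₁ := G.neighborFinset p) (s₂ := farSet G d u v))
    (inter_subset_right (s₁ := G.neighborFinset q) (s₂ := farSet G d u v)))
  have h4 := hD u v huv
  have h5 := (mem_inter.2 ⟨hyp, hyq⟩)
  -- Two subsets of size at least k - e in a set of size at most e share at least 2(k - e) - e ≥ 2
  -- elements. So p and q have a common neighbour besides y: a 4-cycle, contradicting girth at least
  -- 6.
  have hlt : 1 < #((G.neighborFinset p ∩ farSet G d u v) ∩
      (G.neighborFinset q ∩ farSet G d u v)) := by omega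
  obtain ⟨z, hz, hzy⟩ := exists_mem_ne hlt y
  simp only [mem_inter, SimpleGraph.mem_neighborFinset] at hz h5
  have hpq' : G.dist q p = 1 + 1 := by
    have e1 := hc.dist_triangle (u := q) (v := y) (w := p)
    rw [SimpleGraph.dist_eq_one_iff_adj.2 h5.2.1,
      SimpleGraph.dist_eq_one_iff_adj.2 h5.1.1.symm] at e1
    have e2 := hc.pos_dist_of_ne hpq.symm
    have e3 : G.dist q p ≠ 1 := by
      intro h
      rw [SimpleGraph.dist_eq_one_iff_adj] at h
      have := dist_ne_of_adj_of_lt (x := y) hg h (hc y q)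
        (by rw [SimpleGraph.dist_eq_one_iff_adj.2 h5.2.1.symm]; omega)
      rw [SimpleGraph.dist_eq_one_iff_adj.2 h5.2.1.symm,
        SimpleGraph.dist_eq_one_iff_adj.2 h5.1.1.symm] at this
      exact this rfl
    omega
  exact hzy (eq_of_adj_of_dist_eq hg (by omega) hpq' hz.1.1 h5.1.1
    (SimpleGraph.dist_eq_one_iff_adj.2 hz.2.1) (SimpleGraph.dist_eq_one_iff_adj.2 h5.2.1))

/-- Otherwise all k neighbours of y would be far from both ends, exceeding e. -/
lemma dist_le_or_dist_le (hr : G.IsRegularOfDegree k)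
    (hD : ∀ u v, G.Adj u v → #(farSet G d u v) ≤ e) (he : e < k) {u v y : V} (huv : G.Adj u v) :
    G.dist u y ≤ d ∨ G.dist v y ≤ d := by
  by_contra! h
  have h1 : G.neighborFinset y ⊆ farSet G d u v := by
    intro w hw
    rw [SimpleGraph.mem_neighborFinset] at hw
    have e1 := dist_le_succ_of_adj (x := u) hw.symm
    have e2 := dist_le_succ_of_adj (x := v) hw.symm
    simp only [farSet, mem_filter, mem_univ, true_and]
    omega
  have h2 := card_le_card h1
  rw [SimpleGraph.card_neighborFinset_eq_degree, hr y] at h2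
  have := hD u v huv
  omega

/-- In small excess the diameter is at most `d + 1`. -/
lemma dist_le_succ (hr : G.IsRegularOfDegree k) (hc : G.Connected)
    (hD : ∀ u v, G.Adj u v → #(farSet G d u v) ≤ e) (he : e < k) (x y : V) :
    G.dist x y ≤ d + 1 := by
  obtain ⟨v, hxv⟩ : ∃ v, G.Adj x v := by
    rw [← SimpleGraph.degree_pos_iff_exists_adj, hr x]; omega
  have h1 := hc.dist_triangle (u := x) (v := v) (w := y)
  rw [SimpleGraph.dist_eq_one_iff_adj.2 hxv] at h1
  rcases dist_le_or_dist_le hr hD he (y := y) hxv with h | h <;> omega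

/-- In small excess, the ends of an edge are at different distances from any vertex. -/
lemma dist_ne_of_adj (hr : G.IsRegularOfDegree k) (hg : 2 * d ≤ G.girth) (hd : 3 ≤ d)
    (hc : G.Connected) (hD : ∀ u v, G.Adj u v → #(farSet G d u v) ≤ e)
    (he : e + 2 ≤ k) (hek : 3 * e + 2 ≤ 2 * k) {u v : V} (huv : G.Adj u v) (y : V) :
    G.dist y u ≠ G.dist y v := by
  intro h
  rcases lt_trichotomy (G.dist y u) d with h1 | h1 | h1
  · exact dist_ne_of_adj_of_lt hg huv (hc y u) h1 h
  · exact not_dist_eq_and_dist_eq hr hg hd hc hD he hek huv (y := y)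
      (by rw [SimpleGraph.dist_comm, h1]) (by rw [SimpleGraph.dist_comm, ← h, h1])
  · have := dist_le_or_dist_le hr hD (by omega) (y := y) huv
    rw [SimpleGraph.dist_comm, SimpleGraph.dist_comm (u := v)] at this
    omega

end Bipartite

/-- In a connected graph where the ends of each edge are at different distances from every vertex,
the parity of the distance is given by a two-colouring. -/
lemma neg_one_pow_dist {V : Type*} {G : SimpleGraph V} (hc : G.Connected)
    (hne : ∀ u v, G.Adj u v → ∀ y, G.dist y u ≠ G.dist y v) (o x y : V) :
    (-1 : ℚ) ^ G.dist x y = (-1) ^ G.dist o x * (-1) ^ G.dist o y := by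
  have step : ∀ a b, G.Adj a b → ∀ y, (-1 : ℚ) ^ G.dist y b = -(-1) ^ G.dist y a := by
    intro a b hab y
    have h1 := hne a b hab y
    have h2 := dist_le_succ_of_adj (x := y) hab
    have h3 := dist_le_succ_of_adj (x := y) hab.symm
    rcases Nat.lt_or_gt_of_ne h1 with h | h
    · rw [show G.dist y b = G.dist y a + 1 by omega, pow_succ]; ring
    · rw [show G.dist y a = G.dist y b + 1 by omega, pow_succ]; ring
  have walk : ∀ a b (p : G.Walk a b) y, (-1 : ℚ) ^ G.dist y b =
      (-1) ^ p.length * (-1) ^ G.dist y a := by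
    intro a b p y
    induction p with
    | nil => simp
    | cons h p ih => rw [ih, step _ _ h, SimpleGraph.Walk.length_cons, pow_succ]; ring
  obtain ⟨p, hp⟩ := hc.exists_walk_length_eq_dist o y
  rw [walk o y p x, hp, SimpleGraph.dist_comm (u := x)]
  ring

/-! ### Distance polynomials and their irreducibility. -/

section DistPoly

open Polynomial

/-- The polynomials `P₀ = 1`, `P₁ = X`, `Pₙ₊₂ = X Pₙ₊₁ - q Pₙ`. -/
noncomputable def distPoly (q : ℤ) : ℕ → ℤ[X]
  | 0 => 1
  | 1 => X
  | n + 2 => X * distPoly q (n + 1) - C q * distPoly q n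

lemma distPoly_monic_natDegree (q : ℤ) (n : ℕ) :
    ((distPoly q n).Monic ∧ (distPoly q n).natDegree = n) ∧
      (distPoly q (n + 1)).Monic ∧ (distPoly q (n + 1)).natDegree = n + 1 := by
  induction n with
  | zero => simp [distPoly, monic_X]
  | succ n ih =>
    refine ⟨ih.2, ?_⟩
    have h1 : (X * distPoly q (n + 1)).Monic := monic_X.mul ih.2.1
    have h2 : (X * distPoly q (n + 1)).natDegree = n + 2 := by
      rw [monic_X.natDegree_mul ih.2.1, ih.2.2, natDegree_X]; omega
    have h3 : (C q * distPoly q n).natDegree ≤ n := by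
      refine (natDegree_C_mul_le _ _).trans ih.1.2.le
    have h4 : (C q * distPoly q n).degree < (X * distPoly q (n + 1)).degree :=
      degree_lt_degree (by omega)
    exact ⟨h1.sub_of_left h4,
      (natDegree_sub_eq_left_of_natDegree_lt (by omega)).trans h2⟩

/-- Modulo 2 the recursion loses its second term, so Pₙ reduces to Xⁿ. Two consecutive indices are
carried because the recursion has order two. -/
lemma two_dvd_distPoly_sub {q : ℤ} (hq : 2 ∣ q) (n : ℕ) :
    C 2 ∣ distPoly q n - X ^ n ∧ C 2 ∣ distPoly q (n + 1) - X ^ (n + 1) := by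
  induction n with
  | zero => simp [distPoly]
  | succ n ih =>
    refine ⟨ih.2, ?_⟩
    have h : distPoly q (n + 1 + 1) - X ^ (n + 1 + 1) =
        X * (distPoly q (n + 1) - X ^ (n + 1)) - C q * distPoly q n := by
      rw [distPoly]; ring
    rw [h]
    exact dvd_sub (ih.2.mul_left _) ((_root_.map_dvd C hq).mul_right _)

lemma two_dvd_coeff_distPoly {q : ℤ} (hq : 2 ∣ q) {n i : ℕ} (hi : i ≠ n) :
    2 ∣ (distPoly q n).coeff i := by
  have := C_dvd_iff_dvd_coeff _ _ |>.1 (two_dvd_distPoly_sub hq n).1 i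
  rwa [coeff_sub, coeff_X_pow, if_neg hi, sub_zero] at this

/-- The constant term of Pₙ is -q times that of Pₙ₋₂, and both factors are even once n - 2 ≥ 1. For
n = 2 it is only -q, hence the bound on n. -/
lemma four_dvd_coeff_zero_distPoly {q : ℤ} (hq : 2 ∣ q) {n : ℕ} (hn : 3 ≤ n) :
    4 ∣ (distPoly q n).coeff 0 := by
  obtain ⟨m, rfl⟩ := Nat.exists_eq_add_of_le' (show 2 ≤ n by omega)
  rw [distPoly, coeff_sub, mul_coeff_zero, coeff_X_zero, zero_mul, coeff_C_mul, zero_sub, dvd_neg]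
  exact mul_dvd_mul hq (two_dvd_coeff_distPoly hq (by omega))

/-- For even `q`, the polynomials `Pₙ ± 2` with `n ≥ 3` are irreducible over `ℚ`. -/
lemma irreducible_distPoly_add {q : ℤ} (hq : 2 ∣ q) {n : ℕ} (hn : 3 ≤ n) {c : ℤ}
    (hc : c = 2 ∨ c = -2) :
    Irreducible ((distPoly q n + C c).map (Int.castRingHom ℚ)) ∧
      ((distPoly q n + C c).map (Int.castRingHom ℚ)).natDegree = n := by
  obtain ⟨hm, hd⟩ := (distPoly_monic_natDegree q n).1
  have hdeg : (distPoly q n + C c).natDegree = n := by rw [natDegree_add_C, hd]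
  have hmon : (distPoly q n + C c).Monic := by
    refine hm.add_of_left (degree_lt_degree ?_)
    rw [natDegree_C]; omega
  have hc2 : 2 ∣ c := by rcases hc with rfl | rfl <;> decide
  have heis : (distPoly q n + C c).IsEisensteinAt (Ideal.span {2}) := by
    refine ⟨hmon.leadingCoeff_notMem ?_, fun {i} hi => ?_, ?_⟩
    · rw [Ne, Ideal.span_singleton_eq_top, Int.isUnit_iff]; decide
    · rw [Ideal.mem_span_singleton, coeff_add]
      refine dvd_add (two_dvd_coeff_distPoly hq (by omega)) ?_
      rw [coeff_C]
      split_ifs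
      · exact hc2
      · exact dvd_zero _
    -- The constant term is ±2 plus a multiple of 4, so it is not divisible by 4.
    · rw [Ideal.span_singleton_pow, Ideal.mem_span_singleton, coeff_add, coeff_C_zero]
      have := four_dvd_coeff_zero_distPoly hq hn
      intro h
      have h' : (4 : ℤ) ∣ (distPoly q n).coeff 0 + c := by simpa using h
      rcases hc with rfl | rfl <;> omega
  have hprime : (Ideal.span {(2 : ℤ)}).IsPrime :=
    (Ideal.span_singleton_prime two_ne_zero).2 Int.prime_two
  have hirr := heis.irreducible hprime hmon.isPrimitive (by omega)
  refine ⟨?_, by rw [hmon.natDegree_map, hdeg]⟩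
  exact (hmon.irreducible_iff_irreducible_map_fraction_map (K := ℚ)).1 hirr

/-- The value of `Pₙ` at `q + 1` is `1 + q + ... + qⁿ`. -/
lemma eval_distPoly (q : ℤ) (n : ℕ) :
    (distPoly q n).eval (q + 1) = ∑ i ∈ Finset.range (n + 1), q ^ i ∧
      (distPoly q (n + 1)).eval (q + 1) = ∑ i ∈ Finset.range (n + 2), q ^ i := by
  induction n with
  | zero => simp [distPoly, Finset.sum_range_succ, add_comm]
  | succ n ih =>
    refine ⟨ih.2, ?_⟩
    rw [distPoly, eval_sub, eval_mul, eval_mul, eval_X, eval_C, ih.1, ih.2,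
      Finset.sum_range_succ _ (n + 2), Finset.sum_range_succ _ (n + 1)]
    ring

end DistPoly

/-! ### Dimensions of spaces killed by an irreducible polynomial. -/

section Irreducible

open Polynomial Module

/-- An endomorphism annihilated by an irreducible polynomial acts on a space whose dimension is
divisible by the degree of the polynomial. -/
lemma natDegree_dvd_finrank {K W : Type*} [Field K] [AddCommGroup W] [Module K W]
    [FiniteDimensional K W] {p : K[X]} (hp : Irreducible p) (f : End K W) (hf : aeval f p = 0) :
    p.natDegree ∣ finrank K W := by
  have : Fact (Irreducible p) := ⟨hp⟩
  let φ : AdjoinRoot p →ₐ[K] End K W :=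
    Ideal.Quotient.liftₐ (Ideal.span {p}) (aeval f) (fun a ha => by
      obtain ⟨b, rfl⟩ := Ideal.mem_span_singleton.1 ha
      rw [map_mul, hf, zero_mul])
  let _ : Module (AdjoinRoot p) W := Module.compHom W φ.toRingHom
  have : IsScalarTower K (AdjoinRoot p) W := ⟨fun a b w => by
    change φ (a • b) w = a • φ b w
    rw [map_smul, LinearMap.smul_apply]⟩
  have := (AdjoinRoot.powerBasis hp.ne_zero).finite
  rw [← finrank_mul_finrank K (AdjoinRoot p) W, (AdjoinRoot.powerBasis hp.ne_zero).finrank,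
    AdjoinRoot.powerBasis_dim]
  exact dvd_mul_right _ _

lemma natDegree_dvd_finrank_submodule {K M : Type*} [Field K] [AddCommGroup M] [Module K M]
    [FiniteDimensional K M] {p : K[X]} (hp : Irreducible p) (f : End K M) (W : Submodule K M)
    (hW : ∀ w ∈ W, f w ∈ W) (hf : ∀ w ∈ W, aeval f p w = 0) :
    p.natDegree ∣ finrank K W := by
  refine natDegree_dvd_finrank hp (f.restrict hW) ?_
  have h : ∀ (r : K[X]) (w : W), (aeval (f.restrict hW) r w : M) = aeval f r (w : M) := by
    intro r w
    induction r using Polynomial.induction_on' with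
    | add a b ha hb => simp [ha, hb]
    | monomial n a =>
      simp only [aeval_monomial, Module.algebraMap_end_eq_smul_id, Module.End.mul_apply,
        LinearMap.smul_apply, LinearMap.id_apply, Submodule.coe_smul]
      congr 1
      rw [Module.End.pow_restrict]
      rfl
  ext w
  rw [h p w, hf w w.2]
  rfl

lemma finrank_inf_ker_add_one {K M : Type*} [Field K] [AddCommGroup M] [Module K M]
    [FiniteDimensional K M] (W : Submodule K M) (φ : M →ₗ[K] K) {w : M} (hw : w ∈ W)
    (h : φ w ≠ 0) : finrank K (W ⊓ φ.ker : Submodule K M) + 1 = finrank K W := by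
  have h1 := LinearMap.finrank_range_add_finrank_ker (φ.comp W.subtype)
  have h2 : (φ.comp W.subtype).range = ⊤ := by
    refine LinearMap.range_eq_top.2 (LinearMap.surjective ?_)
    intro h0
    exact h (by simpa using LinearMap.congr_fun h0 ⟨w, hw⟩)
  have h3 : finrank K (φ.comp W.subtype).ker = finrank K (W ⊓ φ.ker : Submodule K M) := by
    rw [LinearMap.ker_comp, ← Submodule.finrank_map_subtype_eq W, Submodule.map_comap_subtype]
  rw [h2, finrank_top, finrank_self, h3] at h1
  omega

end Irreducible

/-! ### 2-regular graphs and the eigenvalues ±2. -/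

section Cycles

open Finset

/-- A finite connected graph all of whose vertices have two neighbours is a cycle. -/
lemma exists_iso_cycleGraph {W : Type*} [Finite W] {H : SimpleGraph W} (hc : H.Connected)
    (h2 : ∀ x, (H.neighborSet x).ncard = 2) :
    ∃ l, 3 ≤ l ∧ Nonempty (H ≃g SimpleGraph.cycleGraph l) := by
  classical
  have := Fintype.ofFinite W
  obtain ⟨v⟩ := hc.nonempty
  have hcyc : H.IsCycles := fun x _ => h2 x
  obtain ⟨p, hp, hv⟩ := hcyc.exists_cycle_toSubgraph_verts_eq_connectedComponentSupp
    (c := H.connectedComponentMk v) (v := v) rfl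
    (Set.nonempty_of_ncard_ne_zero (by rw [h2]; decide))
  have hl := hp.three_le_length
  obtain ⟨f⟩ := (SimpleGraph.cycleGraph_isContained_iff (G := H) (n := p.length) (by omega)).2
    ⟨v, p, hp, rfl⟩
  -- The cycle visits every vertex; dropping the repeated starting point from its support leaves
  -- `p.length` entries.
  have hcard : Fintype.card W ≤ p.length := by
    have h1 : (univ : Finset W) ⊆ p.support.tail.toFinset := by
      intro x _
      have hx : x ∈ p.toSubgraph.verts := by
        rw [hv]
        exact SimpleGraph.ConnectedComponent.sound (hc.preconnected x v)
      rw [SimpleGraph.Walk.mem_verts_toSubgraph] at hx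
      rw [List.mem_toFinset]
      rcases (SimpleGraph.Walk.mem_support_iff p).1 hx with rfl | hx
      · exact SimpleGraph.Walk.end_mem_tail_support hp.not_nil
      · exact hx
    have h2 := (card_le_card h1).trans (List.toFinset_card_le _)
    rw [List.length_tail, SimpleGraph.Walk.length_support] at h2
    simpa using h2
  have hinj : Function.Injective f.toHom := f.injective
  have hbij : Function.Bijective f.toHom := by
    refine (Fintype.bijective_iff_injective_and_card _).2 ⟨hinj, ?_⟩
    have := Fintype.card_le_of_injective _ hinj
    rw [Fintype.card_fin] at this ⊢
    omega
  refine ⟨p.length, hl, ⟨SimpleGraph.Iso.symm ⟨Equiv.ofBijective _ hbij, ?_⟩⟩⟩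
  intro a b
  rw [Equiv.ofBijective_apply, Equiv.ofBijective_apply]
  refine ⟨fun hab => ?_, fun hab => f.toHom.map_adj hab⟩
  -- The embedded cycle already supplies both neighbours of each vertex, so H has no further edges
  -- and adjacency is reflected.
  have hsub : f.toHom '' ((SimpleGraph.cycleGraph p.length).neighborSet a) ⊆
      H.neighborSet (f.toHom a) := by
    rintro _ ⟨c, hc, rfl⟩
    exact f.toHom.map_adj hc
  have hn : ∀ m, 3 ≤ m → ∀ c : Fin m, ((SimpleGraph.cycleGraph m).neighborSet c).ncard = 2 := by
    intro m hm c
    obtain ⟨n, rfl⟩ := Nat.exists_eq_add_of_le' hm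
    rw [Set.ncard_eq_toFinset_card']
    exact SimpleGraph.cycleGraph_degree_three_le
  have heq := Set.eq_of_subset_of_ncard_le hsub (by
    rw [h2, Set.ncard_image_of_injective _ hinj, hn _ hl]) (Set.toFinite _)
  have hb : f.toHom b ∈ H.neighborSet (f.toHom a) := hab
  rw [← heq] at hb
  obtain ⟨c, hc, hcb⟩ := hb
  rwa [← hinj hcb]

variable {V : Type*} {H : SimpleGraph V}

lemma isDisjointUnionOfCycles_of_regular [Fintype V] [DecidableRel H.Adj]
    (hr : H.IsRegularOfDegree 2) : IsDisjointUnionOfCycles H := by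
  intro C
  refine exists_iso_cycleGraph C.connected_toSimpleGraph fun x => ?_
  have h : Subtype.val '' (C.toSimpleGraph.neighborSet x) = H.neighborSet x.1 := by
    ext y
    constructor
    · rintro ⟨z, hz, rfl⟩
      exact hz
    · intro hy
      have hyC : y ∈ C.supp := (C.mem_supp_congr_adj hy).1 x.2
      exact ⟨⟨y, hyC⟩, hy, rfl⟩
  rw [← Set.ncard_image_of_injective _ Subtype.val_injective, h, Set.ncard_eq_toFinset_card']
  exact hr x.1

/-- The functions that are multiplied by `t` along each edge of `H`. -/
def signSpace (H : SimpleGraph V) (t : ℚ) : Submodule ℚ (V → ℚ) where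
  carrier := {f | ∀ x y, H.Adj x y → f x = t * f y}
  add_mem' := fun {f g} hf hg x y h => by
    rw [Pi.add_apply, Pi.add_apply, hf x y h, hg x y h, mul_add]
  zero_mem' := fun x y _ => by simp
  smul_mem' := fun c f hf x y h => by
    rw [Pi.smul_apply, Pi.smul_apply, hf x y h, smul_eq_mul, smul_eq_mul]; ring

lemma eq_pow_mul_of_mem_signSpace {t : ℚ} {f : V → ℚ} (hf : f ∈ signSpace H t) {x y : V}
    (p : H.Walk x y) : f x = t ^ p.length * f y := by
  induction p with
  | nil => simp
  | cons h p ih => rw [hf _ _ h, ih, SimpleGraph.Walk.length_cons, pow_succ]; ring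

/-- In a 2-regular graph, the eigenspace of the adjacency operator for `2 t`, where `t = ±1`,
consists of the functions multiplied by `t` along each edge. -/
lemma mem_signSpace_iff_sum [Fintype V] [DecidableRel H.Adj] (hr : H.IsRegularOfDegree 2) {t : ℚ}
    (ht : t ^ 2 = 1) {f : V → ℚ} :
    f ∈ signSpace H t ↔ ∀ x, ∑ y ∈ H.neighborFinset x, f y = 2 * t * f x := by
  have hcard : ∀ x, #(H.neighborFinset x) = 2 := fun x => hr x
  constructor
  · intro hf x
    have : ∀ y ∈ H.neighborFinset x, f y = t * f x := fun y hy =>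
      hf y x ((H.mem_neighborFinset x y).1 hy).symm
    rw [sum_congr rfl this, sum_const, hcard]
    simp; ring
  · intro hf
    -- The eigenvalue 2t is extremal for degree 2: the sum of squares over oriented edges vanishes,
    -- hence so does each term.
    have h0 : ∑ x, ∑ y ∈ H.neighborFinset x, (f x - t * f y) ^ 2 = 0 := by
      have e1 : ∑ x, ∑ y ∈ H.neighborFinset x, f y ^ 2 = ∑ x, 2 * f x ^ 2 := by
        simp_rw [SimpleGraph.neighborFinset_eq_filter, sum_filter]
        rw [sum_comm]
        refine sum_congr rfl fun y _ => ?_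
        have : ∀ x, (if H.Adj x y then f y ^ 2 else 0) = if H.Adj y x then f y ^ 2 else 0 := by
          intro x; simp [H.adj_comm]
        rw [sum_congr rfl fun x _ => this x, ← sum_filter,
          ← SimpleGraph.neighborFinset_eq_filter, sum_const, hcard]
        simp
      have e2 : ∀ x, ∑ y ∈ H.neighborFinset x, (f x - t * f y) ^ 2 =
          ∑ y ∈ H.neighborFinset x, f y ^ 2 - 2 * f x ^ 2 := by
        intro x
        have : ∀ y, (f x - t * f y) ^ 2 = f x ^ 2 - 2 * t * f x * f y + f y ^ 2 := by
          intro y; linear_combination f y ^ 2 * ht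
        rw [sum_congr rfl fun y _ => this y, sum_add_distrib, sum_sub_distrib, sum_const, hcard,
          ← mul_sum, hf x]
        simp only [nsmul_eq_mul, Nat.cast_ofNat]
        linear_combination (-4 * f x ^ 2) * ht
      rw [sum_congr rfl fun x _ => e2 x, sum_sub_distrib, e1, sub_self]
    intro x y hxy
    have h1 := (sum_eq_zero_iff_of_nonneg fun x _ =>
      sum_nonneg fun y _ => sq_nonneg (f x - t * f y)).1 h0 x (mem_univ x)
    have h2 := (sum_eq_zero_iff_of_nonneg fun y _ => sq_nonneg (f x - t * f y)).1 h1 y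
      ((H.mem_neighborFinset x y).2 hxy)
    exact sub_eq_zero.1 (pow_eq_zero_iff two_ne_zero |>.1 h2)

/-- The dimension of the sign space is the number of components that support a nonzero member. -/
lemma finrank_signSpace [Finite V] {t : ℚ} (ht : t ≠ 0) (S : Set H.ConnectedComponent)
    {σ : V → ℚ} (hσ : σ ∈ signSpace H t) (h0 : ∀ x, H.connectedComponentMk x ∈ S → σ x ≠ 0)
    (hS : ∀ f ∈ signSpace H t, ∀ x, H.connectedComponentMk x ∉ S → f x = 0) :
    Module.finrank ℚ (signSpace H t) = S.ncard := by
  classical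
  have := Fintype.ofFinite S
  -- Rescaling σ independently on each component of S is an isomorphism, since a member of the sign
  -- space is determined on a component by its value at one vertex.
  let Φ : (S → ℚ) →ₗ[ℚ] signSpace H t :=
    { toFun := fun g => ⟨fun x => σ x * if h : H.connectedComponentMk x ∈ S
          then g ⟨_, h⟩ else 0, fun x y hxy => by
        have e : H.connectedComponentMk x = H.connectedComponentMk y :=
          SimpleGraph.ConnectedComponent.sound hxy.reachable
        simp only [e]
        rw [hσ x y hxy, mul_assoc]⟩
      map_add' := fun g g' => by
        ext x
        simp only [Submodule.coe_add, Pi.add_apply]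
        split_ifs <;> ring
      map_smul' := fun c g => by
        ext x
        simp only [Submodule.coe_smul, Pi.smul_apply, smul_eq_mul, RingHom.id_apply]
        split_ifs <;> ring }
  have hΦ : ∀ g x, (Φ g : V → ℚ) x = σ x * if h : H.connectedComponentMk x ∈ S
      then g ⟨_, h⟩ else 0 := fun _ _ => rfl
  have hrep : ∀ c, ∃ x, H.connectedComponentMk x = c := fun c => c.exists_rep
  have hbij : Function.Bijective Φ := by
    constructor
    · intro g g' h
      ext ⟨c, hc⟩
      obtain ⟨x, rfl⟩ := hrep c
      have hx := congrFun (congrArg Subtype.val h) x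
      rw [hΦ, hΦ, dif_pos hc, dif_pos hc] at hx
      exact mul_left_cancel₀ (h0 x hc) hx
    · rintro ⟨f, hf⟩
      choose r hr using hrep
      refine ⟨fun c => f (r c.1) / σ (r c.1), Subtype.ext (funext fun x => ?_)⟩
      rw [hΦ]
      split_ifs with h
      · obtain ⟨p⟩ : H.Reachable x (r (H.connectedComponentMk x)) :=
          SimpleGraph.ConnectedComponent.exact (hr _).symm
        have e1 := eq_pow_mul_of_mem_signSpace hf p
        have e2 := eq_pow_mul_of_mem_signSpace hσ p
        have e3 : σ (r (H.connectedComponentMk x)) ≠ 0 := fun h' => h0 x h (by rw [e2, h', mul_zero])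
        change σ x * (f (r (H.connectedComponentMk x)) / σ (r (H.connectedComponentMk x))) = f x
        rw [e1, e2]
        field_simp
      · rw [mul_zero]
        exact (hS f hf x h).symm
  rw [← (LinearEquiv.ofBijective Φ hbij).finrank_eq, Module.finrank_fintype_fun_eq_card,
    ← Nat.card_eq_fintype_card]
  rfl

lemma finrank_signSpace_one [Finite V] (h : IsDisjointUnionOfCycles H) :
    Module.finrank ℚ (signSpace H 1) = numCycles H :=
  finrank_signSpace one_ne_zero {C | ∃ l, IsCycleOfLength C l} (σ := fun _ => 1)
    (fun _ _ _ => by norm_num) (fun _ _ => one_ne_zero) (fun _ _ _ hx => absurd (h _) hx)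

/-- On an even cycle a proper two-colouring gives a nowhere zero member; on an odd cycle one turn
around gives f = -f, so f vanishes. -/
lemma finrank_signSpace_neg_one [Finite V] (h : IsDisjointUnionOfCycles H) :
    Module.finrank ℚ (signSpace H (-1)) = numEvenCycles H := by
  classical
  have hτ : ∀ C : H.ConnectedComponent, ∃ τ : V → ℚ, (∃ l, Even l ∧ IsCycleOfLength C l) →
      (∀ x ∈ C.supp, τ x ≠ 0) ∧ ∀ x ∈ C.supp, ∀ y, H.Adj x y → τ x = -τ y := by
    intro C
    by_cases hC : ∃ l, Even l ∧ IsCycleOfLength C l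
    · obtain ⟨l, hl, -, ⟨i⟩⟩ := hC
      let c := SimpleGraph.cycleGraph.bicoloring_of_even l hl
      refine ⟨fun x => if hx : x ∈ C.supp then (if c (i ⟨x, hx⟩) then 1 else -1) else 0,
        fun _ => ⟨fun x hx => ?_, fun x hx y hxy => ?_⟩⟩
      · simp only [hx, dif_pos]
        split_ifs <;> norm_num
      · have hy : y ∈ C.supp := (C.mem_supp_congr_adj hxy).1 hx
        simp only [hx, hy, dif_pos]
        have hadj : C.toSimpleGraph.Adj ⟨x, hx⟩ ⟨y, hy⟩ := hxy
        have hne := c.valid (i.map_rel_iff.2 hadj)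
        cases h1 : c (i ⟨x, hx⟩) <;> cases h2 : c (i ⟨y, hy⟩) <;> simp_all
    · exact ⟨0, fun h => absurd h hC⟩
  choose τ hτ using hτ
  refine finrank_signSpace (by norm_num) {C | ∃ l, Even l ∧ IsCycleOfLength C l}
    (σ := fun x => if ∃ l, Even l ∧ IsCycleOfLength (H.connectedComponentMk x) l
      then τ (H.connectedComponentMk x) x else 0) (fun x y hxy => ?_) (fun x hx => ?_)
      (fun f hf x hx => ?_)
  · have e : H.connectedComponentMk x = H.connectedComponentMk y :=
      SimpleGraph.ConnectedComponent.sound hxy.reachable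
    simp only [e]
    split_ifs with hC
    · rw [(hτ _ hC).2 x e y hxy, neg_one_mul]
    · simp
  · have hx' : ∃ l, Even l ∧ IsCycleOfLength (H.connectedComponentMk x) l := hx
    simp only [if_pos hx']
    exact (hτ _ hx').1 x rfl
  · obtain ⟨l, hl⟩ := h (H.connectedComponentMk x)
    have hodd : Odd l := by
      rw [← Nat.not_even_iff_odd]
      exact fun he => hx ⟨l, he, hl⟩
    obtain ⟨hl3, ⟨i⟩⟩ := hl
    obtain ⟨n, rfl⟩ := Nat.exists_eq_add_of_le' hl3
    let j : SimpleGraph.cycleGraph (n + 3) →g H :=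
      (H.connectedComponentMk x).toSimpleGraph_hom.comp i.symm.toHom
    have e1 := eq_pow_mul_of_mem_signSpace hf ((SimpleGraph.cycleGraph.cycle n).map j)
    rw [SimpleGraph.Walk.length_map, SimpleGraph.cycleGraph.length_cycle, hodd.neg_one_pow] at e1
    have e2 : f (j 0) = 0 := by linarith
    have hr : H.Reachable x (j 0) :=
      SimpleGraph.ConnectedComponent.exact (i.symm 0).2.symm
    obtain ⟨p⟩ := hr
    rw [eq_pow_mul_of_mem_signSpace hf p, e2, mul_zero]

end Cycles

/-! ### The excess operator as a polynomial in the adjacency operator. -/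

section Spectral

open Finset Polynomial

variable {V : Type*} [Fintype V] {G : SimpleGraph V} [DecidableRel G.Adj] {k d : ℕ}

/-- The linear form `f ↦ ∑ x, g x * f x`. -/
def pairing (g : V → ℚ) : (V → ℚ) →ₗ[ℚ] ℚ where
  toFun f := ∑ x, g x * f x
  map_add' f f' := by simp [mul_add, sum_add_distrib]
  map_smul' c f := by
    simp only [Pi.smul_apply, smul_eq_mul, RingHom.id_apply, mul_sum]
    exact sum_congr rfl fun x _ => by ring

lemma pairing_apply (g f : V → ℚ) : pairing g f = ∑ x, g x * f x := rfl

/-- The adjacency operator is self-adjoint. -/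
lemma sum_mul_sum_neighborFinset (G : SimpleGraph V) [DecidableRel G.Adj] (f g : V → ℚ) :
    ∑ x, g x * ∑ y ∈ G.neighborFinset x, f y = ∑ x, (∑ y ∈ G.neighborFinset x, g y) * f x := by
  simp_rw [SimpleGraph.neighborFinset_eq_filter, sum_filter, mul_sum, sum_mul]
  rw [sum_comm]
  refine sum_congr rfl fun x _ => sum_congr rfl fun y _ => ?_
  simp only [G.adj_comm x y]
  split_ifs <;> ring

/-- These are eigenspaces of a self-adjoint operator for the distinct eigenvalues 2t and 2t'. -/
lemma pairing_eq_zero_of_signSpace {H : SimpleGraph V} [DecidableRel H.Adj]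
    (hr : H.IsRegularOfDegree 2) {t t' : ℚ} (ht : t ^ 2 = 1) (ht' : t' ^ 2 = 1) (h : t ≠ t')
    {f g : V → ℚ} (hf : f ∈ signSpace H t) (hg : g ∈ signSpace H t') : pairing g f = 0 := by
  have h1 := sum_mul_sum_neighborFinset H f g
  rw [mem_signSpace_iff_sum hr ht] at hf
  rw [mem_signSpace_iff_sum hr ht'] at hg
  simp_rw [hf, hg] at h1
  have h2 : 2 * t * pairing g f = 2 * t' * pairing g f := by
    rw [pairing_apply, mul_sum, mul_sum]
    convert h1 using 2 <;> ring
  have h3 : (t - t') * pairing g f = 0 := by linarith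
  exact (mul_eq_zero.1 h3).resolve_left (sub_ne_zero.2 h)

/-- The adjacency operator on rational functions. -/
noncomputable def adjEnd (G : SimpleGraph V) [DecidableRel G.Adj] : Module.End ℚ (V → ℚ) where
  toFun f x := ∑ y ∈ G.neighborFinset x, f y
  map_add' f g := by ext x; simp [sum_add_distrib]
  map_smul' c f := by ext x; simp [mul_sum]

lemma adjEnd_apply (f : V → ℚ) (x : V) : adjEnd G f x = ∑ y ∈ G.neighborFinset x, f y := rfl

/-- In a bipartite regular graph of girth at least `2 d`, the polynomial `Pᵢ`, for `i < d`, of the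
adjacency operator sums over the vertices at distance at most `i` and of the parity of `i`. -/
lemma aeval_distPoly_apply (hr : G.IsRegularOfDegree k) (hg : 2 * d ≤ G.girth)
    (hc : G.Connected) (hne : ∀ u v, G.Adj u v → ∀ y, G.dist y u ≠ G.dist y v) (f : V → ℚ) (i : ℕ)
    (hi : i + 1 < d) :
    (∀ x, aeval (adjEnd G) (distPoly ((k : ℤ) - 1) i) f x =
      ∑ y, if G.dist y x ≤ i ∧ Even (i + G.dist y x) then f y else 0) ∧
    (∀ x, aeval (adjEnd G) (distPoly ((k : ℤ) - 1) (i + 1)) f x =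
      ∑ y, if G.dist y x ≤ i + 1 ∧ Even (i + 1 + G.dist y x) then f y else 0) := by
  classical
  have hstep : ∀ u v, G.Adj u v → ∀ y, G.dist y v = G.dist y u + 1 ∨
      G.dist y u = G.dist y v + 1 := by
    intro u v h y
    have h1 := hne u v h y
    have h2 := dist_le_succ_of_adj (x := y) h
    have h3 := dist_le_succ_of_adj (x := y) h.symm
    omega
  induction i with
  | zero =>
    constructor
    · intro x
      rw [distPoly, map_one, Module.End.one_apply]
      trans ∑ y, if y = x then f y else 0
      · simp
      refine sum_congr rfl fun y _ => ?_
      have : (G.dist y x ≤ 0 ∧ Even (0 + G.dist y x)) ↔ y = x := by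
        rw [← hc.dist_eq_zero_iff]
        constructor
        · intro h; omega
        · intro h; simp [h]
      simp only [this]
    · intro x
      rw [distPoly, aeval_X, adjEnd_apply, SimpleGraph.neighborFinset_eq_filter, sum_filter]
      refine sum_congr rfl fun y _ => ?_
      have : (G.dist y x ≤ 0 + 1 ∧ Even (0 + 1 + G.dist y x)) ↔ G.Adj x y := by
        rw [G.adj_comm, ← SimpleGraph.dist_eq_one_iff_adj]
        constructor
        · rintro ⟨h, h'⟩
          rw [Nat.even_iff] at h'
          omega
        · intro h; rw [h]; decide
      simp only [this]
  | succ i ih =>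
    obtain ⟨ih1, ih2⟩ := ih (by omega)
    refine ⟨ih2, fun x => ?_⟩
    rw [distPoly, map_sub, map_mul, map_mul, aeval_X, aeval_C, LinearMap.sub_apply,
      Module.End.mul_apply, Module.End.mul_apply, Pi.sub_apply, adjEnd_apply,
      sum_congr rfl fun w _ => ih2 w, sum_comm]
    have hC : ∀ g : V → ℚ, algebraMap ℤ (Module.End ℚ (V → ℚ)) ((k : ℤ) - 1) g =
        ((k : ℚ) - 1) • g := by
      intro g
      rw [eq_intCast]
      ext y
      simp [sub_mul]
    rw [hC, Pi.smul_apply, ih1, smul_eq_mul, mul_sum, ← sum_sub_distrib]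
    refine sum_congr rfl fun y _ => ?_
    rw [← sum_filter, sum_const, nsmul_eq_mul]
    have hdeg : #(G.neighborFinset x) = k := hr x
    -- The coefficient of f y is the number of neighbours of x within reach of y at level i + 1,
    -- minus k - 1 if y is within reach of x at level i. It is k - (k - 1) = 1 for distance at most
    -- i, 1 - 0 for distance i + 2 (unique predecessor), and 0 otherwise.
    by_cases hp : Even (i + G.dist y x)
    · have hp' : Even (i + 1 + 1 + G.dist y x) := by
        rw [Nat.even_iff] at hp ⊢; omega
      rcases lt_trichotomy (G.dist y x) (i + 2) with h | h | h
      · have hle : G.dist y x ≤ i := by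
          rw [Nat.even_iff] at hp; omega
        have hall : {w ∈ G.neighborFinset x | G.dist y w ≤ i + 1 ∧ Even (i + 1 + G.dist y w)} =
            G.neighborFinset x := by
          refine filter_true_of_mem fun w hw => ?_
          rw [SimpleGraph.mem_neighborFinset] at hw
          rw [Nat.even_iff] at hp ⊢
          rcases hstep x w hw y with h | h <;> omega
        rw [hall, hdeg, if_pos ⟨hle, hp⟩, if_pos ⟨by omega, hp'⟩]
        ring
      · obtain ⟨w, hw, hwy⟩ := exists_adj_dist_eq (G := G) (x := y) (y := x) (j := i + 1) h
        have hone : {w ∈ G.neighborFinset x | G.dist y w ≤ i + 1 ∧ Even (i + 1 + G.dist y w)} =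
            {w} := by
          ext z
          simp only [mem_filter, SimpleGraph.mem_neighborFinset, mem_singleton]
          constructor
          · rintro ⟨hz, hz', -⟩
            refine eq_of_adj_of_dist_eq hg (j := i + 1) (by omega) h hz hw ?_ hwy
            rcases hstep x z hz y with h | h <;> omega
          · rintro rfl
            exact ⟨hw, hwy.le, by rw [hwy]; exact ⟨i + 1, rfl⟩⟩
        rw [hone, card_singleton, if_neg (by omega), if_pos ⟨by omega, hp'⟩]
        simp
      · have hnone : {w ∈ G.neighborFinset x | G.dist y w ≤ i + 1 ∧
            Even (i + 1 + G.dist y w)} = ∅ := by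
          refine filter_false_of_mem fun w hw => ?_
          rw [SimpleGraph.mem_neighborFinset] at hw
          rcases hstep x w hw y with h | h <;> omega
        rw [hnone, if_neg (by omega), if_neg (by omega)]
        simp
    · have hp' : ¬ Even (i + 1 + 1 + G.dist y x) := by
        rw [Nat.even_iff] at hp ⊢; omega
      have hnone : {w ∈ G.neighborFinset x | G.dist y w ≤ i + 1 ∧
          Even (i + 1 + G.dist y w)} = ∅ := by
        refine filter_false_of_mem fun w hw => ?_
        rw [SimpleGraph.mem_neighborFinset] at hw
        rw [Nat.even_iff] at hp ⊢
        rcases hstep x w hw y with h | h <;> omega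
      rw [hnone, if_neg (fun h => hp h.2), if_neg (fun h => hp' h.2)]
      simp

noncomputable instance decidableRelExcessGraphAdj (G : SimpleGraph V) (d : ℕ) :
    DecidableRel (excessGraph G d).Adj :=
  fun u v => inferInstanceAs (Decidable (G.dist u v = d + 1))

/-- The excess operator expressed through the two-colouring and a polynomial of the adjacency
operator. -/
lemma adjEnd_excessGraph (hr : G.IsRegularOfDegree k) (hg : 2 * d ≤ G.girth)
    (hd : 2 ≤ d) (hc : G.Connected) (hne : ∀ u v, G.Adj u v → ∀ y, G.dist y u ≠ G.dist y v)
    (hdiam : ∀ x y, G.dist x y ≤ d + 1) (o : V) (f : V → ℚ) (x : V) :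
    adjEnd (excessGraph G d) f x = (pairing 1 f + (-1) ^ (d + 1) * (-1) ^ G.dist o x *
      pairing (fun y => (-1) ^ G.dist o y) f) / 2 -
        aeval (adjEnd G) (distPoly ((k : ℤ) - 1) (d - 1)) f x := by
  have h1 := (aeval_distPoly_apply hr hg hc hne f (d - 2) (by omega)).2 x
  rw [show d - 2 + 1 = d - 1 by omega] at h1
  rw [h1, adjEnd_apply, SimpleGraph.neighborFinset_eq_filter, sum_filter, pairing_apply,
    pairing_apply, mul_sum, ← sum_add_distrib, sum_div, ← sum_sub_distrib]
  refine sum_congr rfl fun y _ => ?_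
  have h2 := neg_one_pow_dist hc hne o x y
  have h3 := hdiam x y
  rw [← mul_assoc, mul_assoc ((-1 : ℚ) ^ (d + 1)), ← h2, ← pow_add, SimpleGraph.dist_comm (u := y)]
  have h4 : (excessGraph G d).Adj x y ↔ G.dist x y = d + 1 := Iff.rfl
  simp only [h4, Pi.one_apply]
  -- For the parity of d + 1, the diameter bound leaves distance d + 1 or at most d - 1, and exactly
  -- one indicator is 1. For the other parity every term vanishes.
  by_cases hp : Even (d + 1 + G.dist x y)
  · rw [hp.neg_one_pow]
    have hp' : Even (d - 1 + G.dist x y) := by rw [Nat.even_iff] at hp ⊢; omega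
    simp only [hp', and_true]
    rw [Nat.even_iff] at hp
    by_cases h5 : G.dist x y = d + 1
    · rw [if_pos h5, if_neg (by omega)]; ring
    · rw [if_neg h5, if_pos (by omega)]; ring
  · have hp' : ¬ Even (d - 1 + G.dist x y) := by rw [Nat.even_iff] at hp ⊢; omega
    rw [(Nat.not_even_iff_odd.1 hp).neg_one_pow]
    simp only [hp', and_false, if_false]
    rw [Nat.even_iff] at hp
    rw [if_neg (by omega)]
    ring

lemma adjEnd_one (hr : G.IsRegularOfDegree k) : adjEnd G 1 = (k : ℚ) • (1 : V → ℚ) := by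
  ext x
  rw [adjEnd_apply]
  simp [hr x]

lemma adjEnd_sign (hr : G.IsRegularOfDegree k) {s : V → ℚ}
    (hs : ∀ x y, G.Adj x y → s y = -s x) : adjEnd G s = (-k : ℚ) • s := by
  ext x
  rw [adjEnd_apply, sum_congr rfl fun y hy => hs x y ((G.mem_neighborFinset x y).1 hy)]
  simp [hr x]

lemma pairing_adjEnd (g f : V → ℚ) : pairing g (adjEnd G f) = pairing (adjEnd G g) f :=
  sum_mul_sum_neighborFinset G f g

lemma pairing_smul_left (c : ℚ) (g f : V → ℚ) : pairing (c • g) f = c * pairing g f := by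
  simp [pairing_apply, mul_sum, mul_assoc]

/-- Constants and sign vectors are eigenvectors of a self-adjoint operator for k and -k, which
differ as k ≥ 1. -/
lemma pairing_one_sign (hr : G.IsRegularOfDegree k) (hk : 1 ≤ k) {s : V → ℚ}
    (hs : ∀ x y, G.Adj x y → s y = -s x) : pairing 1 s = 0 := by
  have h := pairing_adjEnd (G := G) 1 s
  rw [adjEnd_one hr, adjEnd_sign hr hs, pairing_smul_left, map_smul, smul_eq_mul] at h
  have hk' : (k : ℚ) ≠ 0 := by positivity
  have : (k : ℚ) * pairing 1 s = 0 := by linarith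
  exact (mul_eq_zero.1 this).resolve_left hk'

/-- The degree of the excess graph is half of the excess. -/
lemma excessGraph_regular (hr : G.IsRegularOfDegree k) (hk : 1 ≤ k) (hg : 2 * d ≤ G.girth)
    (hd : 2 ≤ d) (hc : G.Connected) (hne : ∀ u v, G.Adj u v → ∀ y, G.dist y u ≠ G.dist y v)
    (hdiam : ∀ x y, G.dist x y ≤ d + 1) {r : ℕ}
    (hn : Fintype.card V = 2 * halfMoore k d + 2 * r) :
    (excessGraph G d).IsRegularOfDegree r := by
  intro x
  have hs : ∀ u v, G.Adj u v → (-1 : ℚ) ^ G.dist x v = -(-1) ^ G.dist x u := by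
    intro u v huv
    have h := neg_one_pow_dist hc hne x u v
    rw [SimpleGraph.dist_eq_one_iff_adj.2 huv] at h
    rcases neg_one_pow_eq_or ℚ (G.dist x u) with h1 | h1 <;>
      rw [h1] at h ⊢ <;> linarith
  -- On the constant function the sign term vanishes and P_{d-1}(A) acts as P_{d-1}(k), which is
  -- half the Moore bound; the degree is therefore |V|/2 minus that.
  have h := adjEnd_excessGraph hr hg hd hc hne hdiam x 1 x
  have h1 : pairing (fun y => (-1 : ℚ) ^ G.dist x y) 1 = 0 := by
    rw [← pairing_one_sign hr hk hs]
    simp [pairing_apply]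
  have h2 : ∀ p : ℤ[X], aeval (adjEnd G) p (1 : V → ℚ) = ((p.eval (k : ℤ) : ℤ) : ℚ) • 1 := by
    intro p
    induction p using Polynomial.induction_on' with
    | add p q hp hq => rw [map_add, LinearMap.add_apply, hp, hq, eval_add, Int.cast_add, add_smul]
    | monomial n c =>
      have h3 : ∀ n : ℕ, (adjEnd G ^ n) (1 : V → ℚ) = ((k : ℚ) ^ n) • 1 := by
        intro n
        induction n with
        | zero => simp
        | succ n ih =>
          rw [pow_succ, Module.End.mul_apply, adjEnd_one hr, map_smul, ih, smul_smul, pow_succ,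
            mul_comm]
      rw [aeval_monomial, eval_monomial, Module.End.mul_apply, h3, eq_intCast]
      ext y
      simp [mul_comm]
  have h3 := (eval_distPoly ((k : ℤ) - 1) (d - 1)).1
  rw [sub_add_cancel, show d - 1 + 1 = d by omega] at h3
  have h4 : ((halfMoore k d : ℕ) : ℤ) = ∑ i ∈ range d, ((k : ℤ) - 1) ^ i := by
    rw [halfMoore]
    push_cast [hk]
    rfl
  rw [h1, h2, h3, ← h4, adjEnd_apply] at h
  have h5 : pairing (1 : V → ℚ) 1 = 2 * halfMoore k d + 2 * r := by
    simp only [pairing_apply, Pi.one_apply, mul_one, sum_const, card_univ, hn]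
    simp
  rw [h5] at h
  simp only [Pi.one_apply, sum_const, SimpleGraph.card_neighborFinset_eq_degree, Pi.smul_apply,
    smul_eq_mul, nsmul_eq_mul] at h
  push_cast at h
  have : (((excessGraph G d).degree x : ℕ) : ℚ) = r := by linarith
  exact_mod_cast this

/-- The part of the sign space orthogonal to the constants and the two-colouring has dimension
divisible by `d - 1`. -/
lemma dvd_finrank_signSpace_inf (hr : G.IsRegularOfDegree k) (hk : 1 ≤ k) (hk_odd : Odd k)
    (hg : 2 * d ≤ G.girth) (hd : 4 ≤ d) (hc : G.Connected)
    (hne : ∀ u v, G.Adj u v → ∀ y, G.dist y u ≠ G.dist y v)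
    (hdiam : ∀ x y, G.dist x y ≤ d + 1) (hE : (excessGraph G d).IsRegularOfDegree 2) (o : V)
    {t : ℤ} (ht : t = 1 ∨ t = -1) :
    d - 1 ∣ Module.finrank ℚ ((signSpace (excessGraph G d) (t : ℚ) ⊓ (pairing 1).ker ⊓
      (pairing (fun y => (-1) ^ G.dist o y)).ker : Submodule ℚ (V → ℚ))) := by
  set s : V → ℚ := fun y => (-1) ^ G.dist o y with hsdef
  have hs : ∀ u v, G.Adj u v → s v = -s u := by
    intro u v huv
    have h := neg_one_pow_dist hc hne o u v
    rw [SimpleGraph.dist_eq_one_iff_adj.2 huv] at h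
    simp only [hsdef]
    rcases neg_one_pow_eq_or ℚ (G.dist o u) with h1 | h1 <;>
      rw [h1] at h ⊢ <;> linarith
  -- Odd k makes q = k - 1 even, and d ≥ 4 gives the index d - 1 ≥ 3.
  obtain ⟨hirr, hdeg⟩ := irreducible_distPoly_add (q := (k : ℤ) - 1) (n := d - 1) (c := 2 * t)
    (by obtain ⟨m, rfl⟩ := hk_odd; exact ⟨m, by push_cast; ring⟩) (by omega)
    (by rcases ht with rfl | rfl <;> simp)
  have ht2 : (t : ℚ) ^ 2 = 1 := by rcases ht with rfl | rfl <;> norm_num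
  set p := (distPoly ((k : ℤ) - 1) (d - 1) + C (2 * t)).map (Int.castRingHom ℚ) with hp
  have haeval : ∀ f x, aeval (adjEnd G) p f x =
      aeval (adjEnd G) (distPoly ((k : ℤ) - 1) (d - 1)) f x + 2 * t * f x := by
    intro f x
    have e : aeval (adjEnd G) p = aeval (adjEnd G) (distPoly ((k : ℤ) - 1) (d - 1) + C (2 * t)) :=
      aeval_map_algebraMap ℚ (adjEnd G) _
    rw [e, map_add, aeval_C, LinearMap.add_apply, Pi.add_apply, eq_intCast]
    simp [mul_assoc]
  have key : ∀ f, pairing 1 f = 0 → pairing s f = 0 →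
      (f ∈ signSpace (excessGraph G d) (t : ℚ) ↔ aeval (adjEnd G) p f = 0) := by
    intro f h1 h2
    rw [mem_signSpace_iff_sum hE ht2, funext_iff]
    refine forall_congr' fun x => ?_
    have h := adjEnd_excessGraph hr hg (by omega) hc hne hdiam o f x
    rw [h1, h2, adjEnd_apply] at h
    rw [haeval, h, Pi.zero_apply]
    constructor <;> intro h' <;> linarith
  rw [← hdeg]
  refine natDegree_dvd_finrank_submodule hirr (adjEnd G) _ ?_ ?_
  · rintro f ⟨⟨hf, h1⟩, h2⟩
    have h1 : pairing 1 f = 0 := h1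
    have h2 : pairing s f = 0 := h2
    have h1' : pairing 1 (adjEnd G f) = 0 := by
      rw [pairing_adjEnd, adjEnd_one hr, pairing_smul_left, h1, mul_zero]
    have h2' : pairing s (adjEnd G f) = 0 := by
      rw [pairing_adjEnd, adjEnd_sign hr hs, pairing_smul_left, h2, mul_zero]
    refine ⟨⟨(key _ h1' h2').2 ?_, h1'⟩, h2'⟩
    have h3 := (key f h1 h2).1 hf
    -- The subspace is stable under A because A commutes with p(A) and preserves orthogonality to
    -- its eigenvectors 1 and s.
    have h4 : Commute (aeval (adjEnd G) p) (adjEnd G) := by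
      have := Polynomial.aeval_X (R := ℚ) (adjEnd G)
      nth_rewrite 2 [← this]
      exact (Commute.all p X).map (aeval (adjEnd G))
    have h5 := LinearMap.congr_fun h4.eq f
    rw [Module.End.mul_apply, Module.End.mul_apply, h3, map_zero] at h5
    exact h5
  · rintro f ⟨⟨hf, h1⟩, h2⟩
    exact (key f h1 h2).1 hf

end Spectral

end CageExcess

/-! ### Counting dimensions in the two eigenspaces. -/

theorem mainTheorem4 {V : Type*} [Fintype V] (G : SimpleGraph V) [DecidableRel G.Adj]
    (k d : ℕ) (hk : 7 ≤ k) (hk_odd : Odd k) (hd : 8 ≤ 2 * d)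
    (hG : CageExcess.IsKGGraph G k (2 * d))
    (hexcess : CageExcess.excess V k (2 * d) = 4) :
    CageExcess.IsDisjointUnionOfCycles (CageExcess.excessGraph G d) ∧
    (Odd d →
      (d : ℤ) - 1 ∣ (CageExcess.numCycles (CageExcess.excessGraph G d) : ℤ) - 2 ∧
      (d : ℤ) - 1 ∣ (CageExcess.numEvenCycles (CageExcess.excessGraph G d) : ℤ)) ∧
    (Even d →
      (d : ℤ) - 1 ∣ (CageExcess.numCycles (CageExcess.excessGraph G d) : ℤ) - 1 ∧
      (d : ℤ) - 1 ∣ (CageExcess.numEvenCycles (CageExcess.excessGraph G d) : ℤ) - 1) := by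
  open CageExcess in
  have hr := hG.regular
  have hg : 2 * d ≤ G.girth := hG.girth_eq.ge
  have hn : Fintype.card V = 2 * halfMoore k d + 4 := by
    have h1 : ((halfMoore k d : ℕ) : ℤ) = ∑ i ∈ Finset.range d, ((k : ℤ) - 1) ^ i := by
      rw [halfMoore]
      push_cast [show 1 ≤ k by omega]
      rfl
    rw [excess, mooreBound, if_neg (by simp), Nat.mul_div_cancel_left d two_pos, ← h1] at hexcess
    omega
  have hV : Nonempty V := Fintype.card_pos_iff.1 (by omega)
  have hc := connected_of_card hr hg (by omega) hn
  have hD : ∀ u v, G.Adj u v → (farSet G d u v).card ≤ 4 := fun u v => card_farSet_le hr hg hn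
  have hne : ∀ u v, G.Adj u v → ∀ y, G.dist y u ≠ G.dist y v := fun u v huv y =>
    -- With e = 4 the condition 3e + 2 ≤ 2k is exactly k ≥ 7.
    dist_ne_of_adj hr hg (by omega) hc hD (by omega) (by omega) huv y
  have hdiam : ∀ x y, G.dist x y ≤ d + 1 := dist_le_succ hr hc hD (by omega)
  have hE : (excessGraph G d).IsRegularOfDegree 2 :=
    excessGraph_regular hr (by omega) hg (by omega) hc hne hdiam hn
  have hcyc := isDisjointUnionOfCycles_of_regular hE
  refine ⟨hcyc, ?_⟩
  obtain ⟨o⟩ := hV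
  have hdvd : ∀ t : ℤ, t = 1 ∨ t = -1 → _ := fun t ht =>
    dvd_finrank_signSpace_inf hr (by omega) hk_odd hg (by omega) hc hne hdiam hE o ht
  have hcast : ((d - 1 : ℕ) : ℤ) = (d : ℤ) - 1 := by omega
  rw [← hcast, ← finrank_signSpace_one hcyc, ← finrank_signSpace_neg_one hcyc]
  have h1 := hdvd 1 (Or.inl rfl)
  have h2 := hdvd (-1) (Or.inr rfl)
  rw [Int.cast_one] at h1
  rw [Int.cast_neg, Int.cast_one] at h2
  set s : V → ℚ := fun y => (-1) ^ G.dist o y with hsdef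
  have hss : ∀ x, s x * s x = 1 := fun x => by
    simp only [hsdef, ← pow_add, (Even.add_self _).neg_one_pow]
  have hs1 : pairing 1 s = 0 := by
    refine pairing_one_sign hr (by omega) fun u v huv => ?_
    have h := neg_one_pow_dist hc hne o u v
    rw [SimpleGraph.dist_eq_one_iff_adj.2 huv] at h
    simp only [hsdef]
    rcases neg_one_pow_eq_or ℚ (G.dist o u) with h1 | h1 <;>
      rw [h1] at h ⊢ <;> linarith
  have hcard : (Fintype.card V : ℚ) ≠ 0 := by
    rw [hn]; positivity
  have h11 : pairing (1 : V → ℚ) 1 ≠ 0 := by simpa [pairing_apply] using hcard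
  have hsn : pairing s s ≠ 0 := by simpa [pairing_apply, hss] using hcard
  have h1mem : (1 : V → ℚ) ∈ signSpace (excessGraph G d) 1 := fun _ _ _ => by simp
  have hsmem : s ∈ signSpace (excessGraph G d) ((-1) ^ (d + 1)) := by
    intro x y hxy
    have hxy : G.dist x y = d + 1 := hxy
    have h := neg_one_pow_dist hc hne o x y
    rw [hxy] at h
    rw [h, mul_assoc]
    change s x = s x * (s y * s y)
    rw [hss, mul_one]
  constructor
  · intro hodd
    rw [hodd.add_one.neg_one_pow] at hsmem
    constructor
    -- For odd d both 1 and s lie in the eigenspace for t = 1. They are orthogonal, so the two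
    -- conditions cut the dimension by exactly 2.
    · have e1 := finrank_inf_ker_add_one (signSpace (excessGraph G d) 1) (pairing 1) h1mem h11
      have e2 := finrank_inf_ker_add_one (signSpace (excessGraph G d) 1 ⊓ (pairing 1).ker)
        (pairing s) ⟨hsmem, hs1⟩ hsn
      rw [← e1, ← e2]
      push_cast
      rw [add_assoc, one_add_one_eq_two, add_sub_cancel_right]
      exact Int.natCast_dvd_natCast.2 h1
    -- The eigenspace for t = -1 is already orthogonal to 1 and s, so nothing is lost.
    · rw [inf_eq_left.2, inf_eq_left.2] at h2
      · exact Int.natCast_dvd_natCast.2 h2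
      · exact fun f hf => pairing_eq_zero_of_signSpace hE (by norm_num) (by norm_num)
          (by norm_num) hf h1mem
      · exact fun f hf => pairing_eq_zero_of_signSpace hE (by norm_num) (by norm_num)
          (by norm_num) hf.1 hsmem
  · intro heven
    rw [heven.add_one.neg_one_pow] at hsmem
    constructor
    -- For even d, s moves to the eigenspace for t = -1, so each eigenspace loses one dimension and
    -- is automatically orthogonal to the other vector.
    · have e1 := finrank_inf_ker_add_one (signSpace (excessGraph G d) 1) (pairing 1) h1mem h11
      rw [inf_eq_left.2] at h1
      · rw [← e1]
        push_cast
        rw [add_sub_cancel_right]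
        exact Int.natCast_dvd_natCast.2 h1
      · exact fun f hf => pairing_eq_zero_of_signSpace hE (by norm_num) (by norm_num)
          (by norm_num) hf.1 hsmem
    · have e1 := finrank_inf_ker_add_one (signSpace (excessGraph G d) (-1)) (pairing s) hsmem hsn
      have e2 : signSpace (excessGraph G d) (-1) ⊓ (pairing 1).ker =
          signSpace (excessGraph G d) (-1) :=
        inf_eq_left.2 fun f hf => pairing_eq_zero_of_signSpace hE (by norm_num) (by norm_num)
          (by norm_num) hf h1mem
      rw [e2] at h2
      rw [← e1]
      push_cast
      rw [add_sub_cancel_right]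
      exact Int.natCast_dvd_natCast.2 h2
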